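/- Let $f:\mathbb{R}^d\to\mathbb{R}$ be convex, differentiable and $L$-smooth ($L>0$), i.e. $f(y)\le f(x)+\langle\nabla f(x),y-x\rangle+\frac L2\|y-x\|^2$ for all $x,y\in\mathbb{R}^d$, and let $x_*$ be a minimizer of $f$. Let $T_0=0$ and let $T_1,T_2,\dots$ be random times such that $T_1-T_0,\,T_2-T_1,\,T_3-T_2,\dots$ are i.i.d. of law exponential with rate $1$; let $N=\sum_{k\ge1}\delta_{T_k}$. Fix deterministic $x_0,z_0\in\mathbb{R}^d$. For functions $\eta_t,\eta'_t,\gamma_t,\gamma'_t$ of $t\geq 0$, the continuized acceleration is a càdlàg process $(x_t,z_t)_{t\ge0}$ started at $(x_0,z_0)$ that almost surely satisfies, in integral form, $$\mathrm{d}x_t=\eta_t(z_t-x_t)\,\mathrm{d}t-\gamma_t\nabla f(x_{t-})\,\mathrm{d}N(t),\qquad \mathrm{d}z_t=\eta'_t(x_t-z_t)\,\mathrm{d}t-\gamma'_t\nabla f(x_{t-})\,\mathrm{d}N(t).$$ Its discretization is $\tilde x_k=x_{T_k}$, $\tilde z_k=z_{T_k}$. Its discrete implementation is the recursion started at $\tilde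 x_0=x_0$, $\tilde z_0=z_0$, $$\tilde y_k=\tilde x_k+\tau_k(\tilde z_k-\tilde x_k),\qquad \tilde x_{k+1}=\tilde y_k-\tilde\gamma_k\nabla f(\tilde y_k),\qquad \tilde z_{k+1}=\tilde z_k+\tau'_k(\tilde y_k-\tilde z_k)-\tilde\gamma'_k\nabla f(\tilde y_k).$$ 1. (Convex case.) Take $\eta_t=\frac2t$, $\eta'_t=0$, $\gamma_t=\frac1L$, $\gamma'_t=\frac t{2L}$, respectively $\tau_k=1-\left(\frac{T_k}{T_{k+1}}\right)^2$, $\tau'_k=0$, $\tilde\gamma_k=\frac1L$, $\tilde\gamma'_k=\frac{T_{k+1}}{2L}$. Then, both for $\tilde x_k=x_{T_k}$ and for $\tilde x_k$ given by the recursion, for every $k\ge0$ the random variable below is integrable and $$\mathbb{E}\left[T_k^2\left(f(\tilde x_k)-f(x_*)\right)\right]\le 2L\|z_0-x_*\|^2.$$ 2. (Strongly convex case.) Assume further that $f$ is $\mu$-strongly convex, $\mu>0$, i.e. $f(y)\ge f(x)+\langle\nabla f(x),y-x\rangle+\frac\mu2\|y-x\|^2$ for all $x,y$. Take $\eta_t=\eta'_t=\sqrt{\mu/L}$,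 $\gamma_t=\frac1L$, $\gamma'_t=\frac1{\sqrt{\mu L}}$, respectively $\tau_k=\frac12\left(1-\exp\left(-2\sqrt{\tfrac\mu L}(T_{k+1}-T_k)\right)\right)$, $\tau'_k=\tanh\left(\sqrt{\tfrac\mu L}(T_{k+1}-T_k)\right)$, $\tilde\gamma_k=\frac1L$, $\tilde\gamma'_k=\frac1{\sqrt{\mu L}}$. Then, both for $\tilde x_k=x_{T_k}$ and for $\tilde x_k$ given by the recursion, for every $k\ge0$ the random variable below is integrable and $$\mathbb{E}\left[\exp\left(\sqrt{\tfrac\mu L}\,T_k\right)\left(f(\tilde x_k)-f(x_*)\right)\right]\le f(x_0)-f(x_*)+\frac\mu2\|z_0-x_*\|^2.$$ -/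

import Mathlib

open MeasureTheory ProbabilityTheory Filter Topology

noncomputable section

namespace Continuized

/-- The Euclidean space `ℝ^d`. -/
abbrev Vec (d : ℕ) : Type := EuclideanSpace ℝ (Fin d)

/-- `f` is `L`-smooth: `f y ≤ f x + ⟪∇ f x, y - x⟫ + L / 2 * ‖y - x‖ ^ 2` for all `x`, `y`. -/
def LSmooth {d : ℕ} (L : ℝ) (f : Vec d → ℝ) : Prop :=
  ∀ x y, f y ≤ f x + inner ℝ (gradient f x) (y - x) + L / 2 * ‖y - x‖ ^ 2

/-- A differentiable `f` is `μ`-strongly convex: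
`f x + ⟪∇ f x, y - x⟫ + μ / 2 * ‖y - x‖ ^ 2 ≤ f y` for all `x`, `y`. -/
def StronglyConvex {d : ℕ} (μ : ℝ) (f : Vec d → ℝ) : Prop :=
  ∀ x y, f x + inner ℝ (gradient f x) (y - x) + μ / 2 * ‖y - x‖ ^ 2 ≤ f y

/-- `T 1, T 2, …` are the arrival times of a rate `1` Poisson process started at `T 0 = 0`:
the increments `T 1 - T 0, T 2 - T 1, …` are i.i.d. of law exponential with rate `1`. -/
structure IsPoissonArrivals {Ω : Type*} [MeasurableSpace Ω] (P : Measure Ω)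
    (T : ℕ → Ω → ℝ) : Prop where
  zero : ∀ᵐ ω ∂P, T 0 ω = 0
  law : ∀ k, HasLaw (fun ω => T (k + 1) ω - T k ω) (expMeasure 1) P
  indep : iIndepFun (fun k ω => T (k + 1) ω - T k ω) P

/-- A path indexed by `t ≥ 0` is càdlàg: right continuous, with a left limit at every `t > 0`. -/
structure IsCadlag {d : ℕ} (x : ℝ → Vec d) : Prop where
  right : ∀ t, 0 ≤ t → ContinuousWithinAt x (Set.Ici t) t
  left : ∀ t, 0 < t → ∃ l, Tendsto x (𝓝[<] t) (𝓝 l)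

/-- `(x, z)` is a path, started at `(x₀, z₀)`, of the dynamics
`dx_t = η_t (z_t - x_t) dt - γ_t ∇f(x_t) dN(t)`, `dz_t = η'_t (x_t - z_t) dt - γ'_t ∇f(x_t) dN(t)`,
where `dN` is the sum of the Dirac masses at `T 1, T 2, …`. The gradient of a jump is taken at
the left limit of `x`. Adaptedness to the filtration of `N` is not asked for, so that this is
(formally) more general than asking for it. -/
structure IsContinuizedPath {d : ℕ} (f : Vec d → ℝ) (η η' γ γ' : ℝ → ℝ) (T : ℕ → ℝ)
    (x₀ z₀ : Vec d) (x z : ℝ → Vec d) : Prop where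
  cadlag_x : IsCadlag x
  cadlag_z : IsCadlag z
  integrable_x : ∀ t, 0 ≤ t → IntervalIntegrable (fun s => η s • (z s - x s)) volume 0 t
  integrable_z : ∀ t, 0 ≤ t → IntervalIntegrable (fun s => η' s • (x s - z s)) volume 0 t
  eq_x : ∀ t, 0 ≤ t → x t = x₀ + (∫ s in (0 : ℝ)..t, η s • (z s - x s))
    - ∑' k : ℕ, {s : ℝ | s ≤ t}.indicator
        (fun s => γ s • gradient f (Function.leftLim x s)) (T (k + 1))
  eq_z : ∀ t, 0 ≤ t → z t = z₀ + (∫ s in (0 : ℝ)..t, η' s • (x s - z s))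
    - ∑' k : ℕ, {s : ℝ | s ≤ t}.indicator
        (fun s => γ' s • gradient f (Function.leftLim x s)) (T (k + 1))

/-- One step `(x, z) ↦ (x⁺, z⁺)` of an iteration of Nesterov form:
`y = x + τ (z - x)`, `x⁺ = y - γ ∇f(y)`, `z⁺ = z + τ' (y - z) - γ' ∇f(y)`. -/
def nesterovStep {d : ℕ} (f : Vec d → ℝ) (τ τ' γ γ' : ℝ) (p : Vec d × Vec d) : Vec d × Vec d :=
  let y := p.1 + τ • (p.2 - p.1)
  (y - γ • gradient f y, p.2 + τ' • (y - p.2) - γ' • gradient f y)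

/-- The iterates `(x_k, z_k)` of the iteration of Nesterov form with parameter sequences
`τ`, `τ'`, `γ`, `γ'`, started at `(x₀, z₀)`. -/
def nesterovIter {d : ℕ} (f : Vec d → ℝ) (τ τ' γ γ' : ℕ → ℝ) (x₀ z₀ : Vec d) :
    ℕ → Vec d × Vec d
  | 0 => (x₀, z₀)
  | k + 1 => nesterovStep f (τ k) (τ' k) (γ k) (γ' k) (nesterovIter f τ τ' γ γ' x₀ z₀ k)

/-- The continuized path with the parameters of the convex case:
`η_t = 2 / t`, `η'_t = 0`, `γ_t = 1 / L`, `γ'_t = t / (2 L)`. -/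
def IsConvexPath {d : ℕ} (f : Vec d → ℝ) (L : ℝ) (T : ℕ → ℝ) (x₀ z₀ : Vec d)
    (x z : ℝ → Vec d) : Prop :=
  IsContinuizedPath f (fun t => 2 / t) (fun _ => 0) (fun _ => 1 / L) (fun t => t / (2 * L))
    T x₀ z₀ x z

/-- The continuized path with the parameters of the strongly convex case:
`η_t = η'_t = √(μ / L)`, `γ_t = 1 / L`, `γ'_t = 1 / √(μ L)`. -/
def IsStronglyConvexPath {d : ℕ} (f : Vec d → ℝ) (L μ : ℝ) (T : ℕ → ℝ) (x₀ z₀ : Vec d)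
    (x z : ℝ → Vec d) : Prop :=
  IsContinuizedPath f (fun _ => √(μ / L)) (fun _ => √(μ / L)) (fun _ => 1 / L)
    (fun _ => 1 / √(μ * L)) T x₀ z₀ x z

/-- The discrete implementation in the convex case: `τ_k = 1 - (T_k / T_{k+1}) ^ 2`, `τ'_k = 0`,
`γ_k = 1 / L`, `γ'_k = T_{k+1} / (2 L)`. -/
def convexIter {d : ℕ} (f : Vec d → ℝ) (L : ℝ) (T : ℕ → ℝ) (x₀ z₀ : Vec d) :
    ℕ → Vec d × Vec d :=
  nesterovIter f (fun k => 1 - (T k / T (k + 1)) ^ 2) (fun _ => 0) (fun _ => 1 / L)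
    (fun k => T (k + 1) / (2 * L)) x₀ z₀

/-- The discrete implementation in the strongly convex case:
`τ_k = (1 - exp (-2 √(μ / L) (T_{k+1} - T_k))) / 2`, `τ'_k = tanh (√(μ / L) (T_{k+1} - T_k))`,
`γ_k = 1 / L`, `γ'_k = 1 / √(μ L)`. -/
def stronglyConvexIter {d : ℕ} (f : Vec d → ℝ) (L μ : ℝ) (T : ℕ → ℝ) (x₀ z₀ : Vec d) :
    ℕ → Vec d × Vec d :=
  nesterovIter f (fun k => 1 / 2 * (1 - Real.exp (-2 * √(μ / L) * (T (k + 1) - T k))))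
    (fun k => Real.tanh (√(μ / L) * (T (k + 1) - T k))) (fun _ => 1 / L)
    (fun _ => 1 / √(μ * L)) x₀ z₀

end Continuized

end

/-!
# Expectation bounds for the continuized acceleration

Both cases rest on a Lyapunov function of the time and the state: `t² (f x - f x*) + 2 L ‖z - x*‖²`
in the convex case and `exp (√(μ / L) t) (f x - f x* + μ / 2 ‖z - x*‖²)` in the strongly convex
case. Along the flow its derivative, and at a gradient jump its increment, add up to something
nonpositive: the inner products of the gradient with `z - x*` cancel, the squared gradient is
absorbed by the descent lemma `LSmooth.apply_sub_gradient_le`, and what is left is (strong)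
convexity at `x*`.

Since the jumps have rate one, this generator inequality says that, with `G u` the Lyapunov
function after flowing for time `u` and `K u` its value after a jump at that moment,
`exp (-u) K u ≤ -(exp (-u) G u)'`. Integrating over `u > 0` bounds the expectation of the Lyapunov
function after one waiting time and one jump by its value before
(`lintegral_expMeasure_le`). The flow is linear, and solved explicitly by the weights of the discrete
recursion, so that the triples `(T k, x_k, z_k)` of the recursion form a Markov chain driven by the
independent waiting times. The one-step bound therefore iterates (`lintegral_chain_le`), without any
stochastic calculus. All expectations are lower integrals of nonnegative functions until the end,
where integrability comes out as finiteness of the bound.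

The continuized process is reduced to the recursion path by path. Almost surely the arrivals
are strictly increasing; between two of them the integral equation is a linear differential
equation, solved through its constants of motion, and at an arrival the left limit undergoes
a gradient step (`IsConvexPath.apply_eq_convexIter`,
`IsStronglyConvexPath.apply_eq_stronglyConvexIter`).
-/

namespace Continuized

/-! ### Gradient inequalities -/

lemma hasDerivAt_comp_gradient {d : ℕ} {f : Vec d → ℝ} (hdiff : Differentiable ℝ f)
    {c : ℝ → Vec d} {c' : Vec d} {t : ℝ} (hc : HasDerivAt c c' t) :
    HasDerivAt (fun u => f (c u)) (inner ℝ (gradient f (c t)) c') t := by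
  have h := (hdiff (c t)).hasGradientAt.hasFDerivAt.comp_hasDerivAt t hc
  rwa [InnerProductSpace.toDual_apply_apply] at h

lemma add_inner_gradient_le {d : ℕ} {f : Vec d → ℝ} (hconv : ConvexOn ℝ Set.univ f)
    (hdiff : Differentiable ℝ f) (x y : Vec d) :
    f x + inner ℝ (gradient f x) (y - x) ≤ f y := by
  have hline : HasDerivAt (fun t : ℝ => f (x + t • (y - x))) (inner ℝ (gradient f x) (y - x)) 0 := by
    have h : HasDerivAt (fun t : ℝ => x + t • (y - x)) (y - x) 0 := by
      simpa using ((hasDerivAt_id (0 : ℝ)).smul_const (y - x)).const_add x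
    have h2 := hasDerivAt_comp_gradient hdiff h
    rwa [zero_smul, add_zero] at h2
  have hc : ConvexOn ℝ Set.univ (fun t : ℝ => f (x + t • (y - x))) := by
    have := hconv.comp_affineMap (AffineMap.lineMap (k := ℝ) x y)
    simpa [Function.comp_def, AffineMap.lineMap_apply, add_comm] using this
  have h := hc.le_slope_of_hasDerivAt (Set.mem_univ 0) (Set.mem_univ 1) one_pos hline
  rw [slope_def_field, one_smul, zero_smul, add_zero, add_sub_cancel, sub_zero, div_one] at h
  linarith

/-- A gradient step of length `1 / L` decreases an `L`-smooth function by `‖∇ f x‖² / (2 L)`. -/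
lemma LSmooth.apply_sub_gradient_le {d : ℕ} {f : Vec d → ℝ} {L : ℝ} (hL : 0 < L)
    (hf : LSmooth L f) (x : Vec d) :
    f (x - (1 / L) • gradient f x) ≤ f x - 1 / (2 * L) * ‖gradient f x‖ ^ 2 := by
  have h := hf x (x - (1 / L) • gradient f x)
  have e : x - (1 / L) • gradient f x - x = -((1 / L) • gradient f x) := by abel
  rw [e, norm_neg, norm_smul, inner_neg_right, inner_smul_right, real_inner_self_eq_norm_sq,
    Real.norm_of_nonneg (by positivity)] at h
  refine h.trans (le_of_eq ?_)
  field_simp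
  ring

lemma measurable_gradient {d : ℕ} (f : Vec d → ℝ) : Measurable (gradient f) :=
  (InnerProductSpace.toDual ℝ (Vec d)).symm.continuous.measurable.comp (measurable_fderiv ℝ f)

lemma norm_sub_smul_sq {d : ℕ} (a g : Vec d) (r : ℝ) :
    ‖a - r • g‖ ^ 2 = ‖a‖ ^ 2 - 2 * r * inner ℝ g a + r ^ 2 * ‖g‖ ^ 2 := by
  rw [norm_sub_sq_real, inner_smul_right, norm_smul, real_inner_comm, mul_pow, Real.norm_eq_abs,
    sq_abs]
  ring

/-! ### Exponential waiting times -/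

lemma lintegral_expMeasure_one (F : ℝ → ENNReal) :
    ∫⁻ u, F u ∂expMeasure 1 = ∫⁻ u in Set.Ioi 0, ENNReal.ofReal (Real.exp (-u)) * F u := by
  have hm : Measurable (exponentialPDF 1) := (measurable_exponentialPDFReal 1).ennreal_ofReal
  change ∫⁻ u, F u ∂(volume.withDensity (exponentialPDF 1)) = _
  rw [lintegral_withDensity_eq_lintegral_mul_non_measurable₀ _ hm.aemeasurable
    (ae_of_all _ fun u => ENNReal.ofReal_lt_top), ← lintegral_indicator measurableSet_Ioi]
  refine lintegral_congr_ae ?_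
  filter_upwards [Measure.ae_ne volume (0 : ℝ)] with u hu
  rcases lt_or_gt_of_ne hu with h | h
  · simp [exponentialPDF_of_neg h, h.le]
  · simp [exponentialPDF_of_nonneg h.le, h]

/-- The generator inequality in integrated form. Let `G` be the value of a Lyapunov function along
a flow, and `K` its value after a jump. If the drift `G'` plus the jump part `K - G` is
nonpositive, then the expectation of `K` at an exponential time is at most `G 0`: indeed
`exp (-u) K u` is at most the derivative of `-exp (-u) G u`. -/
lemma lintegral_expMeasure_le {G G' K : ℝ → ℝ} (hcont : ContinuousWithinAt G (Set.Ici 0) 0)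
    (hderiv : ∀ u, 0 < u → HasDerivAt G (G' u) u) (hG : ∀ u, 0 ≤ u → 0 ≤ G u)
    (hK : ∀ u, 0 < u → 0 ≤ K u) (hGK : ∀ u, 0 < u → K u ≤ G u - G' u) :
    ∫⁻ u, ENNReal.ofReal (K u) ∂expMeasure 1 ≤ ENNReal.ofReal (G 0) := by
  set H : ℝ → ℝ := fun u => -(Real.exp (-u) * G u) with hH
  set H' : ℝ → ℝ := fun u => Real.exp (-u) * (G u - G' u) with hH'
  have hHc : ContinuousWithinAt H (Set.Ici 0) 0 :=
    ((by fun_prop : Continuous fun u : ℝ => Real.exp (-u)).continuousWithinAt.mul hcont).neg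
  have hHd : ∀ u ∈ Set.Ioi (0 : ℝ), HasDerivAt H (H' u) u := by
    intro u hu
    have h1 : HasDerivAt (fun u : ℝ => Real.exp (-u)) (-Real.exp (-u)) u := by
      simpa using (hasDerivAt_neg u).exp
    refine (h1.mul (hderiv u hu)).neg.congr_deriv ?_
    simp only [hH']
    ring
  have hHpos : ∀ u ∈ Set.Ioi (0 : ℝ), 0 ≤ H' u := fun u hu =>
    mul_nonneg (Real.exp_nonneg _) ((hK u hu).trans (hGK u hu))
  have hHcont : ContinuousOn H (Set.Ici 0) := by
    intro u hu
    rcases (Set.mem_Ici.1 hu).eq_or_lt with rfl | hu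
    · exact hHc
    · exact (hHd u hu).continuousAt.continuousWithinAt
  have hmono : MonotoneOn H (Set.Ici 0) := by
    refine monotoneOn_of_deriv_nonneg (convex_Ici 0) hHcont ?_ ?_
    · rw [interior_Ici]
      exact fun u hu => (hHd u hu).differentiableAt.differentiableWithinAt
    · rw [interior_Ici]
      intro u hu
      rw [(hHd u hu).deriv]
      exact hHpos u hu
  have hle : ∀ u, 0 ≤ u → H u ≤ 0 := fun u hu =>
    neg_nonpos.2 (mul_nonneg (Real.exp_nonneg _) (hG u hu))
  obtain ⟨l, hl⟩ : ∃ l, Tendsto H atTop (𝓝 l) := by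
    have hm : Monotone fun u => H (max u 0) := fun a b hab =>
      hmono (le_max_right a 0) (le_max_right b 0) (max_le_max_right 0 hab)
    refine ⟨_, (tendsto_atTop_ciSup hm ⟨0, ?_⟩).congr' ?_⟩
    · rintro _ ⟨u, rfl⟩
      exact hle _ (le_max_right u 0)
    · filter_upwards [eventually_ge_atTop 0] with u hu
      rw [max_eq_left hu]
  have hl0 : l ≤ 0 := le_of_tendsto hl ((eventually_ge_atTop 0).mono hle)
  rw [lintegral_expMeasure_one]
  calc ∫⁻ u in Set.Ioi 0, ENNReal.ofReal (Real.exp (-u)) * ENNReal.ofReal (K u)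
      ≤ ∫⁻ u in Set.Ioi 0, ENNReal.ofReal (H' u) := by
        refine setLIntegral_mono' measurableSet_Ioi fun u hu => ?_
        rw [← ENNReal.ofReal_mul (Real.exp_nonneg _)]
        exact ENNReal.ofReal_le_ofReal (mul_le_mul_of_nonneg_left (hGK u hu) (Real.exp_nonneg _))
    _ = ENNReal.ofReal (∫ u in Set.Ioi 0, H' u) :=
        (ofReal_integral_eq_lintegral_ofReal (integrableOn_Ioi_deriv_of_nonneg hHc hHd hHpos hl)
          ((ae_restrict_iff' measurableSet_Ioi).2 (ae_of_all _ hHpos))).symm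
    _ ≤ ENNReal.ofReal (G 0) := by
        rw [integral_Ioi_of_hasDerivAt_of_nonneg hHc hHd hHpos hl]
        refine ENNReal.ofReal_le_ofReal ?_
        simp only [hH, neg_zero, Real.exp_zero, one_mul]
        linarith

/-! ### Chains driven by independent noise -/

/-- The Markov chain `X (k + 1) = step (X k, e k)` started at `s₀`, driven by the noise `e`. -/
def chain {S : Type*} (step : S × ℝ → S) (s₀ : S) (e : ℕ → ℝ) : ℕ → S
  | 0 => s₀
  | k + 1 => step (chain step s₀ e k, e k)

/-- The state after `k` steps is a function of the first `k` noises only, which makes it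
independent of the next one. -/
lemma exists_chain_eq {S : Type*} [MeasurableSpace S] {step : S × ℝ → S} (hstep : Measurable step)
    (s₀ : S) (k : ℕ) : ∃ g : (Finset.range k → ℝ) → S, Measurable g ∧
      ∀ e : ℕ → ℝ, chain step s₀ e k = g (fun i => e i) := by
  induction k with
  | zero => exact ⟨fun _ => s₀, measurable_const, fun e => rfl⟩
  | succ k ih =>
    obtain ⟨g, hg, h⟩ := ih
    refine ⟨fun w => step (g (fun i => w ⟨i, Finset.mem_range.2
      ((Finset.mem_range.1 i.2).trans k.lt_succ_self)⟩), w ⟨k, Finset.self_mem_range_succ k⟩),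
      ?_, fun e => ?_⟩
    · exact hstep.comp ((hg.comp (measurable_pi_lambda _ fun i => measurable_pi_apply _)).prodMk
        (measurable_pi_apply _))
    · rw [chain, h]

lemma aemeasurable_chain {S Ω : Type*} [MeasurableSpace S] [MeasurableSpace Ω] {P : Measure Ω}
    {step : S × ℝ → S} (hstep : Measurable step) (s₀ : S) {e : ℕ → Ω → ℝ}
    (he : ∀ k, AEMeasurable (e k) P) (k : ℕ) :
    AEMeasurable (fun ω => chain step s₀ (fun j => e j ω) k) P := by
  obtain ⟨g, hg, h⟩ := exists_chain_eq hstep s₀ k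
  simp only [h]
  exact hg.comp_aemeasurable (aemeasurable_pi_lambda _ fun i => he i)

/-- If one step of the chain does not increase the expectation of `Φ`, from any starting state,
then with independent noise the expectation of `Φ (X k)` is at most `Φ s₀`. -/
lemma lintegral_chain_le {S Ω : Type*} [MeasurableSpace S] [MeasurableSpace Ω] {P : Measure Ω}
    [IsProbabilityMeasure P] {step : S × ℝ → S} (hstep : Measurable step) (s₀ : S)
    {e : ℕ → Ω → ℝ} {ν : Measure ℝ} (hlaw : ∀ k, HasLaw (e k) ν P) (hindep : iIndepFun e P)
    {Φ : S → ENNReal} (hΦ : Measurable Φ) (hle : ∀ s, ∫⁻ u, Φ (step (s, u)) ∂ν ≤ Φ s) (k : ℕ) :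
    ∫⁻ ω, Φ (chain step s₀ (fun j => e j ω) k) ∂P ≤ Φ s₀ := by
  have he : ∀ k, AEMeasurable (e k) P := fun k => (hlaw k).aemeasurable
  induction k with
  | zero => simp [chain]
  | succ k ih =>
    refine le_trans ?_ ih
    have hX := aemeasurable_chain hstep s₀ he k
    have hind : IndepFun (fun ω => chain step s₀ (fun j => e j ω) k) (e k) P := by
      obtain ⟨g, hg, h⟩ := exists_chain_eq hstep s₀ k
      simp only [h]
      have := hindep.indepFun_finset₀ (Finset.range k) {k} (by simp) he
      exact this.comp hg (measurable_pi_apply ⟨k, Finset.mem_singleton_self k⟩)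
    have hν : IsProbabilityMeasure ν := by
      rw [← (hlaw k).map_eq]
      exact Measure.isProbabilityMeasure_map (he k)
    have : IsProbabilityMeasure (P.map fun ω => chain step s₀ (fun j => e j ω) k) :=
      Measure.isProbabilityMeasure_map hX
    simp only [chain]
    have hm : Measurable fun p => Φ (step p) := hΦ.comp hstep
    rw [← lintegral_map' (f := fun p => Φ (step p)) hm.aemeasurable (hX.prodMk (he k)),
      (indepFun_iff_map_prod_eq_prod_map_map hX (he k)).1 hind, (hlaw k).map_eq,
      lintegral_prod _ hm.aemeasurable]
    refine (lintegral_mono fun s => hle s).trans_eq ?_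
    rw [lintegral_map' hΦ.aemeasurable hX]

lemma integrable_and_integral_le {Ω : Type*} [MeasurableSpace Ω] {P : Measure Ω} {F : Ω → ℝ}
    {C : ℝ} (hF : AEMeasurable F P) (h0 : ∀ ω, 0 ≤ F ω) (hC : 0 ≤ C)
    (h : ∫⁻ ω, ENNReal.ofReal (F ω) ∂P ≤ ENNReal.ofReal C) :
    Integrable F P ∧ ∫ ω, F ω ∂P ≤ C := by
  refine ⟨⟨hF.aestronglyMeasurable, ?_⟩, ?_⟩
  · rw [hasFiniteIntegral_iff_ofReal (ae_of_all _ h0)]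
    exact h.trans_lt ENNReal.ofReal_lt_top
  · rw [integral_eq_lintegral_of_nonneg_ae (ae_of_all _ h0) hF.aestronglyMeasurable]
    exact ENNReal.toReal_le_of_le_ofReal hC h

/-! ### Measurability of a step -/

lemma measurable_nesterovStep {α : Type*} [MeasurableSpace α] {d : ℕ} (f : Vec d → ℝ)
    {τ τ' γ γ' : α → ℝ} {p : α → Vec d × Vec d} (hτ : Measurable τ) (hτ' : Measurable τ')
    (hγ : Measurable γ) (hγ' : Measurable γ') (hp : Measurable p) :
    Measurable fun a => nesterovStep f (τ a) (τ' a) (γ a) (γ' a) (p a) := by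
  have hy : Measurable fun a => (p a).1 + τ a • ((p a).2 - (p a).1) := by fun_prop
  have hg : Measurable fun a => gradient f ((p a).1 + τ a • ((p a).2 - (p a).1)) :=
    (measurable_gradient f).comp hy
  exact (hy.sub (hγ.smul hg)).prodMk
    ((hp.snd.add (hτ'.smul (hy.sub hp.snd))).sub (hγ'.smul hg))

/-! ### The convex case -/

/-- One step of the chain `(T k, (x_k, z_k))` of the convex case; the noise is the waiting time
`T (k + 1) - T k`. -/
noncomputable def convexStep {d : ℕ} (f : Vec d → ℝ) (L : ℝ) (q : (ℝ × Vec d × Vec d) × ℝ) :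
    ℝ × Vec d × Vec d :=
  (q.1.1 + q.2, nesterovStep f (1 - (q.1.1 / (q.1.1 + q.2)) ^ 2) 0 (1 / L)
    ((q.1.1 + q.2) / (2 * L)) q.1.2)

lemma measurable_convexStep {d : ℕ} (f : Vec d → ℝ) (L : ℝ) : Measurable (convexStep f L) := by
  refine Measurable.prodMk (by fun_prop) (measurable_nesterovStep f ?_ ?_ ?_ ?_ ?_) <;> fun_prop

/-- The Lyapunov function `t² (f x - f x*) + 2 L ‖z - x*‖²` of the convex case. -/
noncomputable def convexLyapunov {d : ℕ} (f : Vec d → ℝ) (L : ℝ) (xstar : Vec d)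
    (s : ℝ × Vec d × Vec d) : ℝ :=
  s.1 ^ 2 * (f s.2.1 - f xstar) + 2 * L * ‖s.2.2 - xstar‖ ^ 2

section

variable {d : ℕ} {f : Vec d → ℝ} {L : ℝ} {xstar : Vec d}

lemma convexLyapunov_nonneg (hL : 0 < L) (hmin : ∀ y, f xstar ≤ f y) (s : ℝ × Vec d × Vec d) :
    0 ≤ convexLyapunov f L xstar s :=
  add_nonneg (mul_nonneg (sq_nonneg _) (sub_nonneg.2 (hmin _))) (by positivity)

lemma convexLyapunov_jump_le (hL : 0 < L) (hsmooth : LSmooth L f) (t : ℝ) (y z : Vec d) :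
    convexLyapunov f L xstar (t, y - (1 / L) • gradient f y, z - (t / (2 * L)) • gradient f y) ≤
      convexLyapunov f L xstar (t, y, z) - 2 * t * inner ℝ (gradient f y) (z - xstar) := by
  have h1 := mul_le_mul_of_nonneg_left (hsmooth.apply_sub_gradient_le hL y) (sq_nonneg t)
  simp only [convexLyapunov]
  rw [sub_right_comm, norm_sub_smul_sq]
  have e : 2 * L * (‖z - xstar‖ ^ 2 - 2 * (t / (2 * L)) * inner ℝ (gradient f y) (z - xstar)
      + (t / (2 * L)) ^ 2 * ‖gradient f y‖ ^ 2) = 2 * L * ‖z - xstar‖ ^ 2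
      - 2 * t * inner ℝ (gradient f y) (z - xstar)
      + t ^ 2 * (1 / (2 * L) * ‖gradient f y‖ ^ 2) := by
    field_simp
  rw [e]
  linarith

/-- One step of the chain, started at a time `s.1 ≥ 0`, does not increase the expected
Lyapunov function. -/
lemma lintegral_convexLyapunov_step_le (hL : 0 < L) (hconv : ConvexOn ℝ Set.univ f)
    (hdiff : Differentiable ℝ f) (hsmooth : LSmooth L f) (hmin : ∀ y, f xstar ≤ f y)
    {s : ℝ × Vec d × Vec d} (hs : 0 ≤ s.1) :
    ∫⁻ u, ENNReal.ofReal (convexLyapunov f L xstar (convexStep f L (s, u))) ∂expMeasure 1 ≤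
      ENNReal.ofReal (convexLyapunov f L xstar s) := by
  obtain ⟨s, x, z⟩ := s
  simp only at hs
  set y : ℝ → Vec d := fun u => x + (1 - (s / (s + u)) ^ 2) • (z - x) with hy
  set y' : ℝ → Vec d := fun u => (2 * s ^ 2 / (s + u) ^ 3) • (z - x) with hy'
  have hyd : ∀ u, 0 < s + u → HasDerivAt y (y' u) u := by
    intro u hu
    have h1 : HasDerivAt (fun u : ℝ => 1 - (s / (s + u)) ^ 2) (2 * s ^ 2 / (s + u) ^ 3) u := by
      have h2 := ((((hasDerivAt_id u).const_add s).fun_inv hu.ne').const_mul s).fun_pow 2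
      simp only [id, ← div_eq_mul_inv] at h2
      refine (h2.const_sub 1).congr_deriv ?_
      have := hu.ne'
      simp only [Nat.cast_ofNat, Nat.add_one_sub_one, pow_one]
      field_simp
    exact (h1.smul_const (z - x)).const_add x
  set G : ℝ → ℝ := fun u => convexLyapunov f L xstar (s + u, y u, z) with hG
  have hGd : ∀ u, 0 < s + u → HasDerivAt G (2 * (s + u) * (f (y u) - f xstar)
      + (s + u) ^ 2 * inner ℝ (gradient f (y u)) (y' u)) u := by
    intro u hu
    have h1 : HasDerivAt (fun u : ℝ => (s + u) ^ 2) (2 * (s + u)) u := by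
      simpa using ((hasDerivAt_id u).const_add s).fun_pow 2
    exact (h1.fun_mul ((hasDerivAt_comp_gradient hdiff (hyd u hu)).sub_const (f xstar))).add_const
      (2 * L * ‖z - xstar‖ ^ 2)
  have hG0 : G 0 = convexLyapunov f L xstar (s, x, z) := by
    rcases hs.eq_or_lt with rfl | hs
    · simp [hG, convexLyapunov]
    · simp [hG, hy, hs.ne']
  have hGc : ContinuousWithinAt G (Set.Ici 0) 0 := by
    rcases hs.eq_or_lt with rfl | hs
    · have hf := hdiff.continuous
      have : Continuous G := by
        simp only [hG, hy, convexLyapunov, zero_div]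
        fun_prop
      exact this.continuousWithinAt
    · exact (hGd 0 (by simpa using hs)).continuousAt.continuousWithinAt
  rw [← hG0]
  refine lintegral_expMeasure_le hGc (fun u hu => hGd u (by positivity))
    (fun u _ => convexLyapunov_nonneg hL hmin _) (fun u _ => convexLyapunov_nonneg hL hmin _) ?_
  intro u hu
  have ht : 0 < s + u := by positivity
  have h1 := convexLyapunov_jump_le (xstar := xstar) hL hsmooth (s + u) (y u) z
  have h2 := add_inner_gradient_le hconv hdiff (y u) xstar
  -- the flow moves `y` with velocity `2 / t * (z - y)`
  have h3 : (s + u) ^ 2 * inner ℝ (gradient f (y u)) (y' u)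
      = 2 * (s + u) * inner ℝ (gradient f (y u)) (z - y u) := by
    have e : z - y u = (s / (s + u)) ^ 2 • (z - x) := by
      simp only [hy]
      module
    rw [e, hy', inner_smul_right, inner_smul_right]
    field_simp
  have h4 : inner ℝ (gradient f (y u)) (z - xstar) = inner ℝ (gradient f (y u)) (z - y u)
      - inner ℝ (gradient f (y u)) (xstar - y u) := by
    rw [← inner_sub_right, sub_sub_sub_cancel_right]
  have h5 : convexStep f L ((s, x, z), u) = (s + u, y u - (1 / L) • gradient f (y u),
      z - ((s + u) / (2 * L)) • gradient f (y u)) := by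
    simp [convexStep, nesterovStep, hy]
  rw [h5, h3]
  rw [h4] at h1
  have h6 := mul_nonneg ht.le (sub_nonneg.2 h2)
  simp only [hG]
  linarith

end

/-! ### The strongly convex case -/

/-- One step of the chain `(T k, (x_k, z_k))` of the strongly convex case; the noise is the
waiting time `T (k + 1) - T k`. -/
noncomputable def stronglyConvexStep {d : ℕ} (f : Vec d → ℝ) (L μ : ℝ)
    (q : (ℝ × Vec d × Vec d) × ℝ) :
    ℝ × Vec d × Vec d :=
  (q.1.1 + q.2, nesterovStep f (1 / 2 * (1 - Real.exp (-2 * √(μ / L) * q.2)))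
    (Real.tanh (√(μ / L) * q.2)) (1 / L) (1 / √(μ * L)) q.1.2)

lemma measurable_stronglyConvexStep {d : ℕ} (f : Vec d → ℝ) (L μ : ℝ) :
    Measurable (stronglyConvexStep f L μ) := by
  have : Measurable Real.tanh := by
    have h : Real.tanh = fun x => Real.sinh x / Real.cosh x := funext Real.tanh_eq_sinh_div_cosh
    rw [h]
    fun_prop
  refine Measurable.prodMk (by fun_prop) (measurable_nesterovStep f ?_ ?_ ?_ ?_ ?_) <;> fun_prop

/-- The Lyapunov function `exp (√(μ / L) t) (f x - f x* + μ / 2 ‖z - x*‖²)` of the strongly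
convex case. -/
noncomputable def stronglyConvexLyapunov {d : ℕ} (f : Vec d → ℝ) (L μ : ℝ) (xstar : Vec d)
    (s : ℝ × Vec d × Vec d) : ℝ :=
  Real.exp (√(μ / L) * s.1) * (f s.2.1 - f xstar + μ / 2 * ‖s.2.2 - xstar‖ ^ 2)

/-- The weight `tanh` of the recursion, applied to `y - z`, is the flow of the coupled linear
equations `x' = c (z - x)`, `z' = c (x - z)`. -/
lemma tanh_smul_sub {d : ℕ} (r : ℝ) (x z : Vec d) :
    Real.tanh r • (x + (1 / 2 * (1 - Real.exp (-2 * r))) • (z - x) - z)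
      = (1 / 2 * (1 - Real.exp (-2 * r))) • (x - z) := by
  have e : x + (1 / 2 * (1 - Real.exp (-2 * r))) • (z - x) - z
      = (1 / 2 * (1 + Real.exp (-2 * r))) • (x - z) := by
    module
  rw [e, smul_smul]
  congr 1
  have h1 : Real.exp (-2 * r) = Real.exp (-r) * Real.exp (-r) := by
    rw [← Real.exp_add]
    ring_nf
  have h2 : Real.exp r * Real.exp (-r) = 1 := by
    rw [← Real.exp_add]
    simp
  have h3 : Real.exp r + Real.exp (-r) ≠ 0 := by positivity
  rw [h1, Real.tanh_eq_sinh_div_cosh, Real.sinh_eq, Real.cosh_eq]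
  field_simp
  linear_combination 2 * Real.exp (-r) * h2

section

variable {d : ℕ} {f : Vec d → ℝ} {L μ : ℝ} {xstar : Vec d}

lemma stronglyConvexLyapunov_nonneg (hμ : 0 < μ) (hmin : ∀ y, f xstar ≤ f y)
    (s : ℝ × Vec d × Vec d) : 0 ≤ stronglyConvexLyapunov f L μ xstar s :=
  mul_nonneg (Real.exp_nonneg _) (add_nonneg (sub_nonneg.2 (hmin _)) (by positivity))

lemma stronglyConvexLyapunov_jump_le (hL : 0 < L) (hμ : 0 < μ) (hsmooth : LSmooth L f) (t : ℝ)
    (y z : Vec d) :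
    stronglyConvexLyapunov f L μ xstar
        (t, y - (1 / L) • gradient f y, z - (1 / √(μ * L)) • gradient f y) ≤
      stronglyConvexLyapunov f L μ xstar (t, y, z)
        - Real.exp (√(μ / L) * t) * (√(μ / L) * inner ℝ (gradient f y) (z - xstar)) := by
  simp only [stronglyConvexLyapunov]
  rw [← mul_sub]
  refine mul_le_mul_of_nonneg_left ?_ (Real.exp_nonneg _)
  have h1 := hsmooth.apply_sub_gradient_le hL y
  have h2 : μ * (1 / √(μ * L)) = √(μ / L) := by
    rw [Real.sqrt_mul hμ.le, Real.sqrt_div hμ.le]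
    have := Real.mul_self_sqrt hμ.le
    field_simp
    linarith
  have h3 : μ * (1 / √(μ * L)) ^ 2 = 1 / L := by
    rw [div_pow, Real.sq_sqrt (by positivity)]
    field_simp
  rw [sub_right_comm, norm_sub_smul_sq]
  have e : μ / 2 * (‖z - xstar‖ ^ 2 - 2 * (1 / √(μ * L)) * inner ℝ (gradient f y) (z - xstar)
      + (1 / √(μ * L)) ^ 2 * ‖gradient f y‖ ^ 2) = μ / 2 * ‖z - xstar‖ ^ 2
      - √(μ / L) * inner ℝ (gradient f y) (z - xstar) + 1 / (2 * L) * ‖gradient f y‖ ^ 2 := by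
    rw [← h2]
    have h4 : 1 / (2 * L) = μ * (1 / √(μ * L)) ^ 2 / 2 := by
      rw [h3]
      field_simp
    rw [h4]
    ring
  rw [e]
  linarith

/-- One step of the chain does not increase the expected Lyapunov function. -/
lemma lintegral_stronglyConvexLyapunov_step_le (hL : 0 < L) (hμ : 0 < μ)
    (hdiff : Differentiable ℝ f) (hsmooth : LSmooth L f) (hstrong : StronglyConvex μ f)
    (hmin : ∀ y, f xstar ≤ f y) (s : ℝ × Vec d × Vec d) :
    ∫⁻ u, ENNReal.ofReal (stronglyConvexLyapunov f L μ xstar (stronglyConvexStep f L μ (s, u)))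
        ∂expMeasure 1 ≤
      ENNReal.ofReal (stronglyConvexLyapunov f L μ xstar s) := by
  obtain ⟨s, x, z⟩ := s
  set c : ℝ := √(μ / L) with hc
  set τ : ℝ → ℝ := fun u => 1 / 2 * (1 - Real.exp (-2 * c * u)) with hτ
  set y : ℝ → Vec d := fun u => x + τ u • (z - x) with hy
  set w : ℝ → Vec d := fun u => z + τ u • (x - z) with hw
  have hτd : ∀ u, HasDerivAt τ (c * (1 - 2 * τ u)) u := by
    intro u
    have h1 : HasDerivAt (fun u : ℝ => -2 * c * u) (-2 * c) u := by
      simpa using (hasDerivAt_id u).const_mul (-2 * c)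
    refine ((h1.exp.const_sub 1).const_mul (1 / 2)).congr_deriv ?_
    simp only [hτ]
    ring
  have hyd : ∀ u, HasDerivAt y (c • (w u - y u)) u := by
    intro u
    refine (((hτd u).smul_const (z - x)).const_add x).congr_deriv ?_
    simp only [hy, hw]
    module
  have hwd : ∀ u, HasDerivAt w (c • (y u - w u)) u := by
    intro u
    refine (((hτd u).smul_const (x - z)).const_add z).congr_deriv ?_
    simp only [hy, hw]
    module
  set G : ℝ → ℝ := fun u => stronglyConvexLyapunov f L μ xstar (s + u, y u, w u) with hG
  have hGd : ∀ u, HasDerivAt G (Real.exp (c * (s + u)) *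
      (c * (f (y u) - f xstar + μ / 2 * ‖w u - xstar‖ ^ 2)
        + c * inner ℝ (gradient f (y u)) (w u - y u)
        + μ * c * inner ℝ (w u - xstar) (y u - w u))) u := by
    intro u
    have h1 : HasDerivAt (fun u : ℝ => Real.exp (c * (s + u))) (Real.exp (c * (s + u)) * c) u := by
      simpa using (((hasDerivAt_id u).const_add s).const_mul c).exp
    have h2 : HasDerivAt (fun u => ‖w u - xstar‖ ^ 2)
        (2 * inner ℝ (w u - xstar) (c • (y u - w u))) u :=
      ((hwd u).sub_const xstar).norm_sq
    refine (h1.mul (((hasDerivAt_comp_gradient hdiff (hyd u)).sub_const (f xstar)).add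
      (h2.const_mul (μ / 2)))).congr_deriv ?_
    rw [inner_smul_right, inner_smul_right]
    simp only [Pi.add_apply]
    ring
  have hG0 : G 0 = stronglyConvexLyapunov f L μ xstar (s, x, z) := by
    simp [hG, hy, hw, hτ]
  rw [← hG0]
  refine lintegral_expMeasure_le (hGd 0).continuousAt.continuousWithinAt (fun u _ => hGd u)
    (fun u _ => stronglyConvexLyapunov_nonneg hμ hmin _)
    (fun u _ => stronglyConvexLyapunov_nonneg hμ hmin _) ?_
  intro u _
  have h1 := stronglyConvexLyapunov_jump_le (xstar := xstar) hL hμ hsmooth (s + u) (y u) (w u)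
  have h2 := hstrong (y u) xstar
  have h3 : stronglyConvexStep f L μ ((s, x, z), u) = (s + u, y u - (1 / L) • gradient f (y u),
      w u - (1 / √(μ * L)) • gradient f (y u)) := by
    have h := tanh_smul_sub (c * u) x z
    rw [← mul_assoc] at h
    simp only [stronglyConvexStep, nesterovStep, ← hc, h, hy, hw, hτ]
  rw [h3]
  refine h1.trans ?_
  simp only [hG, stronglyConvexLyapunov, ← hc]
  rw [← mul_sub, ← mul_sub]
  refine mul_le_mul_of_nonneg_left ?_ (Real.exp_nonneg _)
  have h4 : inner ℝ (gradient f (y u)) (w u - xstar) = inner ℝ (gradient f (y u)) (w u - y u)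
      - inner ℝ (gradient f (y u)) (xstar - y u) := by
    rw [← inner_sub_right, sub_sub_sub_cancel_right]
  -- expand the square of `xstar - y = (w - y) - (w - xstar)`
  have h5 : ‖xstar - y u‖ ^ 2 = ‖y u - w u‖ ^ 2 + 2 * inner ℝ (w u - xstar) (y u - w u)
      + ‖w u - xstar‖ ^ 2 := by
    rw [show xstar - y u = -((y u - w u) + (w u - xstar)) by abel, norm_neg, norm_add_sq_real,
      real_inner_comm]
  rw [h4]
  rw [h5] at h2
  have hc0 : 0 ≤ c := Real.sqrt_nonneg _
  have h6 : 0 ≤ μ / 2 * ‖y u - w u‖ ^ 2 := by positivity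
  have h7 := mul_nonneg hc0 (sub_nonneg.2 h2)
  have h8 := mul_nonneg hc0 h6
  linarith

end

/-! ### Paths between two arrivals -/

lemma tsum_indicator_arrivals {E : Type*} [AddCommGroup E] [TopologicalSpace E]
    {T : ℕ → ℝ} (hT : StrictMono T) (v : ℝ → E) {k : ℕ} {t : ℝ}
    (ht : t ∈ Set.Ico (T k) (T (k + 1))) :
    ∑' j : ℕ, {s : ℝ | s ≤ t}.indicator v (T (j + 1)) = ∑ j ∈ Finset.range k, v (T (j + 1)) := by
  rw [tsum_eq_sum (s := Finset.range k)]
  · refine Finset.sum_congr rfl fun j hj => Set.indicator_of_mem ?_ _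
    exact (hT.monotone (Nat.succ_le_of_lt (Finset.mem_range.1 hj))).trans ht.1
  · intro j hj
    refine Set.indicator_of_notMem ?_ _
    rw [Finset.mem_range, not_lt] at hj
    exact not_le.2 (ht.2.trans_le (hT.monotone (Nat.succ_le_succ hj)))

section

variable {E : Type*} [NormedAddCommGroup E] [NormedSpace ℝ E]

lemma eq_left_of_hasDerivAt_zero {h : ℝ → E} {a b : ℝ}
    (hcont : ContinuousWithinAt h (Set.Ici a) a) (hderiv : ∀ t ∈ Set.Ioo a b, HasDerivAt h 0 t)
    {t : ℝ} (ht : t ∈ Set.Ioo a b) : h t = h a := by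
  have hconst : ∀ r ∈ Set.Ioo a t, h r = h t := by
    intro r hr
    refine (constant_of_has_deriv_right_zero (fun u hu => ?_) (fun u hu => ?_) t
      ⟨hr.2.le, le_rfl⟩).symm
    · exact (hderiv u ⟨hr.1.trans_le hu.1, hu.2.trans_lt ht.2⟩).continuousAt.continuousWithinAt
    · exact (hderiv u ⟨hr.1.trans_le hu.1, hu.2.trans ht.2⟩).hasDerivWithinAt
  have h1 : Tendsto h (𝓝[>] a) (𝓝 (h a)) := hcont.mono Set.Ioi_subset_Ici_self
  have h2 : Tendsto h (𝓝[>] a) (𝓝 (h t)) :=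
    tendsto_const_nhds.congr' (by
      filter_upwards [Ioo_mem_nhdsGT ht.1] with r hr using (hconst r hr).symm)
  exact tendsto_nhds_unique h2 h1

variable {T : ℕ → ℝ} {x₀ : E} {x g v : ℝ → E}

/-- A path given by an integral and jumps `v` at the arrivals is, between two arrivals, the
integral up to a constant, and it jumps by `-v` at the next arrival. -/
lemma exists_eq_integral_sub (hT0 : T 0 = 0) (hT : StrictMono T)
    (hx : ∀ t, 0 ≤ t → x t = x₀ + (∫ s in (0 : ℝ)..t, g s)
      - ∑' j : ℕ, {s : ℝ | s ≤ t}.indicator v (T (j + 1))) (k : ℕ) :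
    ∃ C : E, (∀ t ∈ Set.Ico (T k) (T (k + 1)), x t = (∫ s in (0 : ℝ)..t, g s) + C) ∧
      x (T (k + 1)) = (∫ s in (0 : ℝ)..T (k + 1), g s) + C - v (T (k + 1)) := by
  have hpos : ∀ j, 0 ≤ T j := fun j => hT0 ▸ hT.monotone (Nat.zero_le j)
  refine ⟨x₀ - ∑ j ∈ Finset.range k, v (T (j + 1)), fun t ht => ?_, ?_⟩
  · rw [hx t ((hpos k).trans ht.1), tsum_indicator_arrivals hT v ht]
    abel
  · rw [hx _ (hpos _), tsum_indicator_arrivals hT v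
      (⟨le_rfl, hT (Nat.lt_succ_self (k + 1))⟩ : T (k + 1) ∈ Set.Ico (T (k + 1)) (T (k + 1 + 1))),
      Finset.sum_range_succ]
    abel

lemma continuousOn_and_tendsto_of_eq_integral_sub [CompleteSpace E] (hT0 : T 0 = 0)
    (hT : StrictMono T) (hg : ∀ t, 0 ≤ t → IntervalIntegrable g volume 0 t)
    (hx : ∀ t, 0 ≤ t → x t = x₀ + (∫ s in (0 : ℝ)..t, g s)
      - ∑' j : ℕ, {s : ℝ | s ≤ t}.indicator v (T (j + 1))) (k : ℕ) :
    ContinuousOn x (Set.Ioo (T k) (T (k + 1))) ∧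
      Tendsto x (𝓝[<] T (k + 1)) (𝓝 (x (T (k + 1)) + v (T (k + 1)))) := by
  obtain ⟨C, hC, hjump⟩ := exists_eq_integral_sub hT0 hT hx k
  have hpos : ∀ j, 0 ≤ T j := fun j => hT0 ▸ hT.monotone (Nat.zero_le j)
  have hI : ContinuousOn (fun t => (∫ s in (0 : ℝ)..t, g s) + C) (Set.Icc 0 (T (k + 1))) := by
    have := intervalIntegral.continuousOn_primitive_interval' (hg _ (hpos (k + 1)))
      Set.left_mem_uIcc
    rw [Set.uIcc_of_le (hpos (k + 1))] at this
    exact this.add continuousOn_const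
  have hsub : Set.Ioo (T k) (T (k + 1)) ⊆ Set.Icc 0 (T (k + 1)) := fun t ht =>
    ⟨(hpos k).trans ht.1.le, ht.2.le⟩
  refine ⟨(hI.mono hsub).congr fun t ht => hC t ⟨ht.1.le, ht.2⟩, ?_⟩
  rw [hjump, sub_add_cancel]
  have hlt : T k < T (k + 1) := hT k.lt_succ_self
  have h1 : Tendsto (fun t => (∫ s in (0 : ℝ)..t, g s) + C) (𝓝[Set.Ioo (T k) (T (k + 1))] T (k + 1))
      (𝓝 ((∫ s in (0 : ℝ)..T (k + 1), g s) + C)) :=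
    (hI _ ⟨hpos _, le_rfl⟩).mono hsub
  rw [nhdsWithin_Ioo_eq_nhdsLT hlt] at h1
  refine h1.congr' ?_
  filter_upwards [Ioo_mem_nhdsLT hlt] with t ht using (hC t ⟨ht.1.le, ht.2⟩).symm

lemma hasDerivAt_of_eq_integral_sub [CompleteSpace E] (hT0 : T 0 = 0)
    (hT : StrictMono T) (hg : ∀ t, 0 ≤ t → IntervalIntegrable g volume 0 t)
    (hx : ∀ t, 0 ≤ t → x t = x₀ + (∫ s in (0 : ℝ)..t, g s)
      - ∑' j : ℕ, {s : ℝ | s ≤ t}.indicator v (T (j + 1))) {k : ℕ} {t : ℝ}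
    (ht : t ∈ Set.Ioo (T k) (T (k + 1))) (hgt : ContinuousAt g t) : HasDerivAt x (g t) t := by
  obtain ⟨C, hC, -⟩ := exists_eq_integral_sub hT0 hT hx k
  have hpos : ∀ j, 0 ≤ T j := fun j => hT0 ▸ hT.monotone (Nat.zero_le j)
  have hmeas : StronglyMeasurableAtFilter g (𝓝 t) :=
    ⟨Set.Ioc 0 (T (k + 1)), Ioc_mem_nhds ((hpos k).trans_lt ht.1) ht.2,
      (hg _ (hpos (k + 1))).aestronglyMeasurable⟩
  have h := (intervalIntegral.integral_hasDerivAt_right (hg t ((hpos k).trans ht.1.le)) hmeas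
    hgt).add_const C
  refine h.congr_of_eventuallyEq ?_
  filter_upwards [Ioo_mem_nhds ht.1 ht.2] with r hr using hC r ⟨hr.1.le, hr.2⟩

end

section

variable {d : ℕ} {f : Vec d → ℝ} {η η' γ γ' : ℝ → ℝ} {T : ℕ → ℝ} {x₀ z₀ : Vec d}
  {x z : ℝ → Vec d}

lemma IsContinuizedPath.apply_zero (h : IsContinuizedPath f η η' γ γ' T x₀ z₀ x z)
    (hT0 : T 0 = 0) (hT : StrictMono T) : x 0 = x₀ ∧ z 0 = z₀ := by
  have h0 : (0 : ℝ) ∈ Set.Ico (T 0) (T (0 + 1)) := ⟨hT0.le, hT0 ▸ hT zero_lt_one⟩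
  rw [h.eq_x 0 le_rfl, h.eq_z 0 le_rfl, tsum_indicator_arrivals hT _ h0,
    tsum_indicator_arrivals hT _ h0]
  simp

lemma IsContinuizedPath.hasDerivAt (h : IsContinuizedPath f η η' γ γ' T x₀ z₀ x z)
    (hT0 : T 0 = 0) (hT : StrictMono T) (hη : ∀ t, 0 < t → ContinuousAt η t)
    (hη' : ∀ t, 0 < t → ContinuousAt η' t) {k : ℕ} {t : ℝ}
    (ht : t ∈ Set.Ioo (T k) (T (k + 1))) :
    HasDerivAt x (η t • (z t - x t)) t ∧ HasDerivAt z (η' t • (x t - z t)) t := by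
  have ht0 : 0 < t := (hT0 ▸ hT.monotone (Nat.zero_le k) : 0 ≤ T k).trans_lt ht.1
  have hx := (continuousOn_and_tendsto_of_eq_integral_sub hT0 hT h.integrable_x h.eq_x
    k).1.continuousAt (Ioo_mem_nhds ht.1 ht.2)
  have hz := (continuousOn_and_tendsto_of_eq_integral_sub hT0 hT h.integrable_z h.eq_z
    k).1.continuousAt (Ioo_mem_nhds ht.1 ht.2)
  exact ⟨hasDerivAt_of_eq_integral_sub hT0 hT h.integrable_x h.eq_x ht
      ((hη t ht0).smul (hz.sub hx)),
    hasDerivAt_of_eq_integral_sub hT0 hT h.integrable_z h.eq_z ht ((hη' t ht0).smul (hx.sub hz))⟩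

/-- If the path agrees with continuous functions `X`, `Z` between two arrivals, then its value at
the second arrival is obtained from that of `X`, `Z` by a gradient jump. -/
lemma IsContinuizedPath.apply_arrival (h : IsContinuizedPath f η η' γ γ' T x₀ z₀ x z)
    (hT0 : T 0 = 0) (hT : StrictMono T) {k : ℕ} {X Z : ℝ → Vec d}
    (hX : ContinuousAt X (T (k + 1))) (hZ : ContinuousAt Z (T (k + 1)))
    (hxX : ∀ t ∈ Set.Ioo (T k) (T (k + 1)), x t = X t)
    (hzZ : ∀ t ∈ Set.Ioo (T k) (T (k + 1)), z t = Z t) :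
    x (T (k + 1)) = X (T (k + 1)) - γ (T (k + 1)) • gradient f (X (T (k + 1))) ∧
      z (T (k + 1)) = Z (T (k + 1)) - γ' (T (k + 1)) • gradient f (X (T (k + 1))) := by
  have hlt : Set.Ioo (T k) (T (k + 1)) ∈ 𝓝[<] T (k + 1) := Ioo_mem_nhdsLT (hT k.lt_succ_self)
  have hx : Tendsto x (𝓝[<] T (k + 1)) (𝓝 (X (T (k + 1)))) :=
    (hX.mono_left nhdsWithin_le_nhds).congr' (by
      filter_upwards [hlt] with t ht using (hxX t ht).symm)
  have hz : Tendsto z (𝓝[<] T (k + 1)) (𝓝 (Z (T (k + 1)))) :=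
    (hZ.mono_left nhdsWithin_le_nhds).congr' (by
      filter_upwards [hlt] with t ht using (hzZ t ht).symm)
  have hlim : Function.leftLim x (T (k + 1)) = X (T (k + 1)) :=
    leftLim_eq_of_tendsto hx
  have h1 := tendsto_nhds_unique
    (continuousOn_and_tendsto_of_eq_integral_sub hT0 hT h.integrable_x h.eq_x k).2 hx
  have h2 := tendsto_nhds_unique
    (continuousOn_and_tendsto_of_eq_integral_sub hT0 hT h.integrable_z h.eq_z k).2 hz
  rw [hlim] at h1 h2
  exact ⟨eq_sub_of_add_eq h1, eq_sub_of_add_eq h2⟩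

/-- At the arrivals, the path of the convex case agrees with the iterates: between two arrivals
`z` and `t² (x - z)` are constant. -/
theorem IsConvexPath.apply_eq_convexIter {L : ℝ} (h : IsConvexPath f L T x₀ z₀ x z)
    (hT0 : T 0 = 0) (hT : StrictMono T) (k : ℕ) :
    (x (T k), z (T k)) = convexIter f L T x₀ z₀ k := by
  have hd := fun {k : ℕ} {t : ℝ} (ht : t ∈ Set.Ioo (T k) (T (k + 1))) =>
    IsContinuizedPath.hasDerivAt h hT0 hT
      (fun t ht => continuousAt_const.div continuousAt_id ht.ne') (fun t _ => continuousAt_const) ht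
  induction k with
  | zero =>
    rw [hT0, (IsContinuizedPath.apply_zero h hT0 hT).1, (IsContinuizedPath.apply_zero h hT0 hT).2]
    rfl
  | succ k ih =>
    have hk : 0 ≤ T k := hT0 ▸ hT.monotone (Nat.zero_le k)
    have hzd : ∀ t ∈ Set.Ioo (T k) (T (k + 1)), HasDerivAt z 0 t := fun t ht => by
      simpa using (hd ht).2
    have hz : ∀ t ∈ Set.Ioo (T k) (T (k + 1)), z t = z (T k) := fun t ht =>
      eq_left_of_hasDerivAt_zero (h.cadlag_z.right _ hk) hzd ht
    have hx : ∀ t ∈ Set.Ioo (T k) (T (k + 1)),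
        x t = x (T k) + (1 - (T k / t) ^ 2) • (z (T k) - x (T k)) := by
      intro t ht
      have hc : ContinuousWithinAt (fun t : ℝ => t ^ 2 • (x t - z t)) (Set.Ici (T k)) (T k) :=
        ((continuous_pow 2).continuousWithinAt).smul
          ((h.cadlag_x.right _ hk).sub (h.cadlag_z.right _ hk))
      have h1 := eq_left_of_hasDerivAt_zero hc (fun r hr => ?_) ht
      · have ht0 : t ≠ 0 := (hk.trans_lt ht.1).ne'
        have h2 : x t - z t = (T k / t) ^ 2 • (x (T k) - z (T k)) := by
          rw [div_pow, div_eq_inv_mul, mul_smul, ← h1, smul_smul, inv_mul_cancel₀ (by positivity),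
            one_smul]
        rw [eq_add_of_sub_eq h2, hz t ht]
        module
      · have hr0 : r ≠ 0 := (hk.trans_lt hr.1).ne'
        refine ((hasDerivAt_pow 2 r).smul ((hd hr).1.sub (hd hr).2)).congr_deriv ?_
        have e : r ^ 2 * (2 / r) = 2 * r := by field_simp
        simp only [zero_smul, sub_zero, smul_smul, e, Pi.sub_apply]
        norm_num
        module
    have hX : ContinuousAt (fun t => x (T k) + (1 - (T k / t) ^ 2) • (z (T k) - x (T k)))
        (T (k + 1)) := by
      have : T (k + 1) ≠ 0 := (hk.trans_lt (hT k.lt_succ_self)).ne'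
      fun_prop (disch := assumption)
    obtain ⟨h1, h2⟩ := IsContinuizedPath.apply_arrival h hT0 hT hX
      (continuousAt_const (y := z (T k))) hx hz
    rw [convexIter, nesterovIter, ← convexIter, ← ih, h1, h2]
    simp [nesterovStep]

/-- At the arrivals, the path of the strongly convex case agrees with the iterates: between two
arrivals `x + z` and `exp (2 √(μ / L) t) (z - x)` are constant. -/
theorem IsStronglyConvexPath.apply_eq_stronglyConvexIter {L μ : ℝ}
    (h : IsStronglyConvexPath f L μ T x₀ z₀ x z) (hT0 : T 0 = 0) (hT : StrictMono T) (k : ℕ) :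
    (x (T k), z (T k)) = stronglyConvexIter f L μ T x₀ z₀ k := by
  have hd := fun {k : ℕ} {t : ℝ} (ht : t ∈ Set.Ioo (T k) (T (k + 1))) =>
    IsContinuizedPath.hasDerivAt h hT0 hT (fun t _ => continuousAt_const)
      (fun t _ => continuousAt_const) ht
  induction k with
  | zero =>
    rw [hT0, (IsContinuizedPath.apply_zero h hT0 hT).1, (IsContinuizedPath.apply_zero h hT0 hT).2]
    rfl
  | succ k ih =>
    have hk : 0 ≤ T k := hT0 ▸ hT.monotone (Nat.zero_le k)
    set c : ℝ := √(μ / L) with hc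
    have hxc := h.cadlag_x.right _ hk
    have hzc := h.cadlag_z.right _ hk
    have hsum : ∀ t ∈ Set.Ioo (T k) (T (k + 1)), x t + z t = x (T k) + z (T k) := by
      refine fun t ht => eq_left_of_hasDerivAt_zero (h := fun t => x t + z t) (hxc.add hzc)
        (fun r hr => ?_) ht
      refine ((hd hr).1.add (hd hr).2).congr_deriv ?_
      module
    have hdiff : ∀ t ∈ Set.Ioo (T k) (T (k + 1)),
        z t - x t = Real.exp (-2 * c * (t - T k)) • (z (T k) - x (T k)) := by
      intro t ht
      have he : Continuous fun t : ℝ => Real.exp (2 * c * t) := by fun_prop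
      have h1 := eq_left_of_hasDerivAt_zero (h := fun t => Real.exp (2 * c * t) • (z t - x t))
        (he.continuousWithinAt.smul (hzc.sub hxc)) (fun r hr => ?_) ht
      · have e1 : Real.exp (-2 * c * (t - T k)) =
            Real.exp (-(2 * c * t)) * Real.exp (2 * c * T k) := by
          rw [← Real.exp_add]
          ring_nf
        rw [e1, mul_smul, ← h1, smul_smul, ← Real.exp_add, neg_add_cancel, Real.exp_zero, one_smul]
      · have h2 : HasDerivAt (fun t : ℝ => 2 * c * t) (2 * c) r := by
          simpa using (hasDerivAt_id r).const_mul (2 * c)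
        refine (h2.exp.smul ((hd hr).2.sub (hd hr).1)).congr_deriv ?_
        simp only [Pi.sub_apply]
        module
    set τ : ℝ → ℝ := fun t => 1 / 2 * (1 - Real.exp (-2 * c * (t - T k))) with hτ
    have hτc : Continuous τ := by fun_prop
    have hx : ∀ t ∈ Set.Ioo (T k) (T (k + 1)), x t = x (T k) + τ t • (z (T k) - x (T k)) := by
      intro t ht
      have e : x t = (1 / 2 : ℝ) • ((x t + z t) - (z t - x t)) := by module
      rw [e, hsum t ht, hdiff t ht]
      simp only [hτ]
      module
    have hz : ∀ t ∈ Set.Ioo (T k) (T (k + 1)), z t = z (T k) + τ t • (x (T k) - z (T k)) := by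
      intro t ht
      have e : z t = (1 / 2 : ℝ) • ((x t + z t) + (z t - x t)) := by module
      rw [e, hsum t ht, hdiff t ht]
      simp only [hτ]
      module
    obtain ⟨h1, h2⟩ := IsContinuizedPath.apply_arrival h hT0 hT (by fun_prop) (by fun_prop) hx hz
    have h3 := tanh_smul_sub (c * (T (k + 1) - T k)) (x (T k)) (z (T k))
    rw [← mul_assoc] at h3
    rw [stronglyConvexIter, nesterovIter, ← stronglyConvexIter, ← ih, h1, h2]
    simp only [nesterovStep, ← hc, h3, hτ]

end

/-! ### Expectation bounds at the arrivals -/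

lemma ae_expMeasure_one_pos : ∀ᵐ u ∂expMeasure 1, 0 < u := by
  have hm : MeasurableSet {u : ℝ | ¬0 < u} := by
    simp only [not_lt]
    exact measurableSet_Iic
  rw [ae_iff, ← lintegral_indicator_one hm, lintegral_expMeasure_one]
  refine setLIntegral_eq_zero measurableSet_Ioi fun u hu => ?_
  simp [Set.mem_Ioi.1 hu]

section

variable {Ω : Type*} [MeasurableSpace Ω] {P : Measure Ω} {T : ℕ → Ω → ℝ}

lemma IsPoissonArrivals.ae_strictMono (hT : IsPoissonArrivals P T) :
    ∀ᵐ ω ∂P, T 0 ω = 0 ∧ StrictMono fun j => T j ω := by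
  have h : ∀ k, ∀ᵐ ω ∂P, 0 < T (k + 1) ω - T k ω := fun k =>
    ae_of_ae_map (hT.law k).aemeasurable (by
      rw [(hT.law k).map_eq]
      exact ae_expMeasure_one_pos)
  filter_upwards [hT.zero, ae_all_iff.2 h] with ω h0 h1
  exact ⟨h0, strictMono_nat_of_lt_succ fun k => sub_pos.1 (h1 k)⟩

/-- Expectation bound for a function `F` dominated by a Lyapunov function `Φ` of a chain driven by
the waiting times. -/
lemma IsPoissonArrivals.integrable_and_integral_le [IsProbabilityMeasure P]
    (hT : IsPoissonArrivals P T) {S : Type*} [MeasurableSpace S] {step : S × ℝ → S}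
    (hstep : Measurable step) {s₀ : S} {Φ : S → ENNReal} (hΦ : Measurable Φ)
    (hle : ∀ s, ∫⁻ u, Φ (step (s, u)) ∂expMeasure 1 ≤ Φ s) {F : S → ℝ} (hF : Measurable F)
    (hF0 : ∀ s, 0 ≤ F s) (hFΦ : ∀ s, ENNReal.ofReal (F s) ≤ Φ s) {C : ℝ} (hC : 0 ≤ C)
    (hΦC : Φ s₀ = ENNReal.ofReal C) {R : Ω → ℝ} {k : ℕ}
    (hR : ∀ᵐ ω ∂P, F (chain step s₀ (fun j => T (j + 1) ω - T j ω) k) = R ω) :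
    Integrable R P ∧ ∫ ω, R ω ∂P ≤ C := by
  rw [← integrable_congr hR, ← integral_congr_ae hR]
  have hX := aemeasurable_chain hstep s₀ (fun k => (hT.law k).aemeasurable) k
  refine Continuized.integrable_and_integral_le (hF.comp_aemeasurable hX) (fun ω => hF0 _) hC ?_
  exact (lintegral_mono fun ω => hFΦ _).trans
    ((lintegral_chain_le hstep s₀ hT.law hT.indep hΦ hle k).trans_eq hΦC)

end

section

variable {d : ℕ} {f : Vec d → ℝ} {L μ : ℝ} {x₀ z₀ : Vec d} {T : ℕ → ℝ}

lemma chain_convexStep (hT0 : T 0 = 0) (k : ℕ) :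
    chain (convexStep f L) (0, x₀, z₀) (fun j => T (j + 1) - T j) k =
      (T k, convexIter f L T x₀ z₀ k) := by
  induction k with
  | zero => rw [hT0]; rfl
  | succ k ih =>
    rw [chain, ih, convexStep]
    simp only [add_sub_cancel]
    rfl

lemma chain_stronglyConvexStep (hT0 : T 0 = 0) (k : ℕ) :
    chain (stronglyConvexStep f L μ) (0, x₀, z₀) (fun j => T (j + 1) - T j) k =
      (T k, stronglyConvexIter f L μ T x₀ z₀ k) := by
  induction k with
  | zero => rw [hT0]; rfl
  | succ k ih =>
    rw [chain, ih, stronglyConvexStep]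
    simp only [add_sub_cancel]
    rfl

end

section

variable {Ω : Type*} [MeasurableSpace Ω] {P : Measure Ω} [IsProbabilityMeasure P] {T : ℕ → Ω → ℝ}
  {d : ℕ} {f : Vec d → ℝ} {L μ : ℝ} {x₀ z₀ xstar : Vec d}

theorem convexIter_bound (hL : 0 < L) (hconv : ConvexOn ℝ Set.univ f) (hdiff : Differentiable ℝ f)
    (hsmooth : LSmooth L f) (hmin : ∀ y, f xstar ≤ f y) (hT : IsPoissonArrivals P T) (k : ℕ) :
    Integrable (fun ω => T k ω ^ 2 *
        (f (convexIter f L (fun j => T j ω) x₀ z₀ k).1 - f xstar)) P ∧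
      ∫ ω, T k ω ^ 2 * (f (convexIter f L (fun j => T j ω) x₀ z₀ k).1 - f xstar) ∂P
        ≤ 2 * L * ‖z₀ - xstar‖ ^ 2 := by
  classical
  have hf : Measurable f := hdiff.continuous.measurable
  have hV : Measurable (convexLyapunov f L xstar) := by
    unfold convexLyapunov
    fun_prop
  -- The step inequality is available only from nonnegative times; the value `⊤` elsewhere makes
  -- it trivial there.
  set Φ : ℝ × Vec d × Vec d → ENNReal := fun s =>
    if 0 ≤ s.1 then ENNReal.ofReal (convexLyapunov f L xstar s) else ⊤ with hΦ
  have hΦm : Measurable Φ :=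
    Measurable.ite (measurableSet_le measurable_const measurable_fst) hV.ennreal_ofReal
      measurable_const
  refine hT.integrable_and_integral_le (measurable_convexStep f L) (s₀ := (0, x₀, z₀)) hΦm ?_
    (F := fun s => s.1 ^ 2 * (f s.2.1 - f xstar)) (by fun_prop)
    (fun s => mul_nonneg (sq_nonneg _) (sub_nonneg.2 (hmin _))) ?_ (by positivity) ?_ ?_ (k := k)
  · intro s
    by_cases hs : 0 ≤ s.1
    · have h : ∀ᵐ u ∂expMeasure 1, Φ (convexStep f L (s, u)) =
          ENNReal.ofReal (convexLyapunov f L xstar (convexStep f L (s, u))) := by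
        filter_upwards [ae_expMeasure_one_pos] with u hu
        exact if_pos (add_nonneg hs hu.le)
      rw [lintegral_congr_ae h, show Φ s = _ from if_pos hs]
      exact lintegral_convexLyapunov_step_le hL hconv hdiff hsmooth hmin hs
    · rw [show Φ s = ⊤ from if_neg hs]
      exact le_top
  · intro s
    by_cases hs : 0 ≤ s.1
    · rw [show Φ s = _ from if_pos hs]
      exact ENNReal.ofReal_le_ofReal (le_add_of_nonneg_right (by positivity))
    · rw [show Φ s = ⊤ from if_neg hs]
      exact le_top
  · simp [hΦ, convexLyapunov]
  · filter_upwards [hT.zero] with ω h0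
    rw [chain_convexStep (T := fun j => T j ω) h0]

theorem stronglyConvexIter_bound (hL : 0 < L) (hμ : 0 < μ) (hdiff : Differentiable ℝ f)
    (hsmooth : LSmooth L f) (hstrong : StronglyConvex μ f) (hmin : ∀ y, f xstar ≤ f y)
    (hT : IsPoissonArrivals P T) (k : ℕ) :
    Integrable (fun ω => Real.exp (√(μ / L) * T k ω) *
        (f (stronglyConvexIter f L μ (fun j => T j ω) x₀ z₀ k).1 - f xstar)) P ∧
      ∫ ω, Real.exp (√(μ / L) * T k ω) *
        (f (stronglyConvexIter f L μ (fun j => T j ω) x₀ z₀ k).1 - f xstar) ∂P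
        ≤ f x₀ - f xstar + μ / 2 * ‖z₀ - xstar‖ ^ 2 := by
  have hf : Measurable f := hdiff.continuous.measurable
  have hV : Measurable (stronglyConvexLyapunov f L μ xstar) := by
    unfold stronglyConvexLyapunov
    fun_prop
  refine hT.integrable_and_integral_le (measurable_stronglyConvexStep f L μ) (s₀ := (0, x₀, z₀))
    hV.ennreal_ofReal
    (lintegral_stronglyConvexLyapunov_step_le hL hμ hdiff hsmooth hstrong hmin)
    (F := fun s => Real.exp (√(μ / L) * s.1) * (f s.2.1 - f xstar)) (by fun_prop)
    (fun s => mul_nonneg (Real.exp_nonneg _) (sub_nonneg.2 (hmin _))) ?_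
    (add_nonneg (sub_nonneg.2 (hmin _)) (by positivity)) ?_ ?_ (k := k)
  · intro s
    exact ENNReal.ofReal_le_ofReal
      (mul_le_mul_of_nonneg_left (le_add_of_nonneg_right (by positivity)) (Real.exp_nonneg _))
  · simp [stronglyConvexLyapunov]
  · filter_upwards [hT.zero] with ω h0
    rw [chain_stronglyConvexStep (T := fun j => T j ω) h0]

end

end Continuized

theorem theorem5 {d : ℕ} (f : Continuized.Vec d → ℝ) (L : ℝ) (hL : 0 < L)
    (hconv : ConvexOn ℝ Set.univ f) (hdiff : Differentiable ℝ f)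
    (hsmooth : Continuized.LSmooth L f)
    (xstar : Continuized.Vec d) (hmin : ∀ y, f xstar ≤ f y)
    {Ω : Type*} [MeasurableSpace Ω] (P : Measure Ω) [IsProbabilityMeasure P]
    (T : ℕ → Ω → ℝ) (hT : Continuized.IsPoissonArrivals P T)
    (x₀ z₀ : Continuized.Vec d) (k : ℕ) :
    -- convex case, discrete implementation
    (Integrable (fun ω => T k ω ^ 2 *
        (f (Continuized.convexIter f L (fun j => T j ω) x₀ z₀ k).1 - f xstar)) P ∧
      ∫ ω, T k ω ^ 2 *
        (f (Continuized.convexIter f L (fun j => T j ω) x₀ z₀ k).1 - f xstar) ∂P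
        ≤ 2 * L * ‖z₀ - xstar‖ ^ 2) ∧
    -- convex case, continuized process stopped at `T k`
    (∀ x z : ℝ → Ω → Continuized.Vec d,
      (∀ᵐ ω ∂P, Continuized.IsConvexPath f L (fun j => T j ω) x₀ z₀
        (fun t => x t ω) (fun t => z t ω)) →
      Integrable (fun ω => T k ω ^ 2 * (f (x (T k ω) ω) - f xstar)) P ∧
      ∫ ω, T k ω ^ 2 * (f (x (T k ω) ω) - f xstar) ∂P ≤ 2 * L * ‖z₀ - xstar‖ ^ 2) ∧
    (∀ μ : ℝ, 0 < μ → Continuized.StronglyConvex μ f →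
      -- strongly convex case, discrete implementation
      (Integrable (fun ω => Real.exp (√(μ / L) * T k ω) *
          (f (Continuized.stronglyConvexIter f L μ (fun j => T j ω) x₀ z₀ k).1 - f xstar)) P ∧
        ∫ ω, Real.exp (√(μ / L) * T k ω) *
          (f (Continuized.stronglyConvexIter f L μ (fun j => T j ω) x₀ z₀ k).1 - f xstar) ∂P
          ≤ f x₀ - f xstar + μ / 2 * ‖z₀ - xstar‖ ^ 2) ∧
      -- strongly convex case, continuized process stopped at `T k`
      (∀ x z : ℝ → Ω → Continuized.Vec d,
        (∀ᵐ ω ∂P, Continuized.IsStronglyConvexPath f L μ (fun j => T j ω) x₀ z₀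
          (fun t => x t ω) (fun t => z t ω)) →
        Integrable (fun ω => Real.exp (√(μ / L) * T k ω) * (f (x (T k ω) ω) - f xstar)) P ∧
        ∫ ω, Real.exp (√(μ / L) * T k ω) * (f (x (T k ω) ω) - f xstar) ∂P
          ≤ f x₀ - f xstar + μ / 2 * ‖z₀ - xstar‖ ^ 2)) := by
  have hc := Continuized.convexIter_bound (x₀ := x₀) (z₀ := z₀) hL hconv hdiff hsmooth hmin hT k
  refine ⟨hc, fun x z hxz => ?_, fun μ hμ hstrong => ?_⟩
  · have h : (fun ω => T k ω ^ 2 * (f (Continuized.convexIter f L (fun j => T j ω) x₀ z₀ k).1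
        - f xstar)) =ᵐ[P] fun ω => T k ω ^ 2 * (f (x (T k ω) ω) - f xstar) := by
      filter_upwards [hxz, hT.ae_strictMono] with ω hω hTω
      rw [← hω.apply_eq_convexIter hTω.1 hTω.2 k]
    rwa [← integrable_congr h, ← integral_congr_ae h]
  · have hs := Continuized.stronglyConvexIter_bound (x₀ := x₀) (z₀ := z₀) hL hμ hdiff hsmooth
      hstrong hmin hT k
    refine ⟨hs, fun x z hxz => ?_⟩
    have h : (fun ω => Real.exp (√(μ / L) * T k ω) *
        (f (Continuized.stronglyConvexIter f L μ (fun j => T j ω) x₀ z₀ k).1 - f xstar)) =ᵐ[P]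
        fun ω => Real.exp (√(μ / L) * T k ω) * (f (x (T k ω) ω) - f xstar) := by
      filter_upwards [hxz, hT.ae_strictMono] with ω hω hTω
      rw [← hω.apply_eq_stronglyConvexIter hTω.1 hTω.2 k]
    rwa [← integrable_congr h, ← integral_congr_ae h]
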